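/- Let $X_1,\dots,X_n$ be real random variables whose joint distribution is symmetric (invariant under permutations of the coordinates) and MTP$_2$, i.e. it has, with respect to some product $\sigma_1\otimes\cdots\otimes\sigma_n$ of $\sigma$-finite Borel measures on $\mathbb R$ (for instance Lebesgue measure), a measurable density $f:\mathbb R^n\to[0,\infty)$ satisfying $$f(x)\,f(y)\le f(x\vee y)\,f(x\wedge y)\qquad\text{for all }x,y\in\mathbb R^n,$$ where $\vee$ and $\wedge$ are the coordinatewise maximum and minimum. Then both of the following conditions hold. (Condition 2.1) For every nonempty $S\subseteq\{1,\dots,n\}$ and every Borel function $\varphi:\mathbb R^{\{1,\dots,n\}\setminus S}\to\mathbb R$ that is nondecreasing (respectively nonincreasing) in each coordinate and for which $\varphi((X_i)_{i\notin S})$ is integrable, the conditional expectation $$z\mapsto E\bigl[\varphi\bigl((X_i)_{i\notin S}\bigr)\,\big|\,\max_{i\in S}X_i=z\bigr]$$ is nondecreasing (respectively nonincreasing) in $z$. (Condition 2.1*) The same holds with $\max_{i\in S}X_i$ replaced by $\min_{i\in S}X_i$. Here the conditional expectation given $Y=z$, which is determined only up to null sets of the distribution of $Y$, is called nondecreasing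 (nonincreasing) in $z$ if it is so on a set of values $z$ having probability one under the distribution of $Y$. -/

import Mathlib

open MeasureTheory ProbabilityTheory
open scoped NNReal ENNReal

noncomputable section

/-- A nonnegative function on `ℝⁿ` is multivariate totally positive of order two (`MTP₂`):
`f(x) f(y) ≤ f(x ∨ y) f(x ∧ y)`, with coordinatewise maximum and minimum. -/
def IsMTP2Fun {n : ℕ} (f : (Fin n → ℝ) → ℝ≥0) : Prop :=
  ∀ x y : Fin n → ℝ, f x * f y ≤ f (x ⊔ y) * f (x ⊓ y)

/-- A distribution on `ℝⁿ` is `MTP₂` if it has an `MTP₂` density with respect to a product of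
`σ`-finite measures on the line (for instance Lebesgue measure, or counting measures on
countable sets). -/
def IsMTP2 {n : ℕ} (P : Measure (Fin n → ℝ)) : Prop :=
  ∃ σ : Fin n → Measure ℝ, (∀ i, SigmaFinite (σ i)) ∧
    ∃ f : (Fin n → ℝ) → ℝ≥0, Measurable f ∧ IsMTP2Fun f ∧
      P = (Measure.pi σ).withDensity (fun x => (f x : ℝ≥0∞))

/-- A distribution on `ℝⁿ` is symmetric (exchangeable) if it is invariant under all permutations
of the coordinates. -/
def IsSymmetricLaw {n : ℕ} (P : Measure (Fin n → ℝ)) : Prop :=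
  ∀ π : Equiv.Perm (Fin n), P.map (fun x i => x (π i)) = P

variable {Ω : Type*} [MeasurableSpace Ω] {n : ℕ}

/-- The subvector of those `X i` with `i ∉ S`. -/
def restOf (X : Fin n → Ω → ℝ) (S : Finset (Fin n)) (ω : Ω) : {i : Fin n // i ∉ S} → ℝ :=
  fun i => X i ω

/-- `max {X i : i ∈ S}`. -/
def maxOver (X : Fin n → Ω → ℝ) (S : Finset (Fin n)) (hS : S.Nonempty) (ω : Ω) : ℝ :=
  S.sup' hS (fun i => X i ω)

/-- `min {X i : i ∈ S}`. -/
def minOver (X : Fin n → Ω → ℝ) (S : Finset (Fin n)) (hS : S.Nonempty) (ω : Ω) : ℝ :=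
  S.inf' hS (fun i => X i ω)

/-- `z ↦ E[φ(X i : i ∉ S) | Y = z]`: the integral of `φ` against the regular conditional
distribution of the subvector given `Y = z`. It is determined up to null sets of the law of
`Y`. -/
def condMean (μ : Measure Ω) [IsFiniteMeasure μ] (X : Fin n → Ω → ℝ) (S : Finset (Fin n))
    (Y : Ω → ℝ) (φ : ({i : Fin n // i ∉ S} → ℝ) → ℝ) (z : ℝ) : ℝ :=
  ∫ r, φ r ∂(condDistrib (restOf X S) Y μ z)

/-- `h` is nondecreasing on a set of full `ν`-measure. -/
def AEMonotone (ν : Measure ℝ) (h : ℝ → ℝ) : Prop :=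
  ∃ A : Set ℝ, (∀ᵐ z ∂ν, z ∈ A) ∧ MonotoneOn h A

/-- `h` is nonincreasing on a set of full `ν`-measure. -/
def AEAntitone (ν : Measure ℝ) (h : ℝ → ℝ) : Prop :=
  ∃ A : Set ℝ, (∀ᵐ z ∂ν, z ∈ A) ∧ AntitoneOn h A

/-- For the given statistic `Y` and every coordinatewise nondecreasing (nonincreasing) Borel
function `φ` such that `φ(X i : i ∉ S)` is integrable, `E[φ(X i : i ∉ S) | Y = z]` is
nondecreasing (nonincreasing) in `z`. -/
def RegressionMonotone (μ : Measure Ω) [IsFiniteMeasure μ] (X : Fin n → Ω → ℝ)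
    (S : Finset (Fin n)) (Y : Ω → ℝ) : Prop :=
  ∀ φ : ({i : Fin n // i ∉ S} → ℝ) → ℝ, Measurable φ →
    Integrable (fun ω => φ (restOf X S ω)) μ →
    (Monotone φ → AEMonotone (μ.map Y) (condMean μ X S Y φ)) ∧
    (Antitone φ → AEAntitone (μ.map Y) (condMean μ X S Y φ))

/-- Monotone regression given the maximum over any nonempty subset of the variables. -/
def MaxCondition (μ : Measure Ω) [IsFiniteMeasure μ] (X : Fin n → Ω → ℝ) : Prop :=
  ∀ (S : Finset (Fin n)) (hS : S.Nonempty), RegressionMonotone μ X S (maxOver X S hS)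

/-- Monotone regression given the minimum over any nonempty subset of the variables. -/
def MinCondition (μ : Measure Ω) [IsFiniteMeasure μ] (X : Fin n → Ω → ℝ) : Prop :=
  ∀ (S : Finset (Fin n)) (hS : S.Nonempty), RegressionMonotone μ X S (minOver X S hS)

end

/-! Write Y for the maximum over S. It suffices that E[φ; Y ∈ A] P(Y ∈ B) ≤ E[φ; Y ∈ B] P(Y ∈ A) for
nondecreasing φ whenever A lies to the left of B: a conditional mean with averages ordered in this
way is monotone off a null set (`aeMonotone_of_setIntegral_mul_le`).

The event Y ∈ A does not fit the lattice operations, since the maximum over S of x ∧ y can be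
smaller than both maxima. Symmetry repairs this: all indices of S contribute equally, so one may fix
k ∈ S and require that x k be the maximum (`IsSymmetricLaw.lintegral_sup'`). The reference measures
may have atoms, so ties are shared equally through `maxWeight`. For x k < y k this weight is itself
compatible with ∨ and ∧ (`maxWeight_mul_le`), and the four functions theorem for the density times
φ, indicators and weight gives the inequality for φ ≥ 0. Truncation and a shift remove the sign
condition; x ↦ -x turns maxima into minima. -/

/-! ### The four functions theorem for product measures. -/

/-- If `a, b ≤ c` and `a b ≤ c d`, then `a + b ≤ c + d`. -/
theorem ENNReal.add_le_add_of_mul_le_mul {a b c d : ℝ≥0∞} (ha : a ≤ c) (hb : b ≤ c)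
    (h : a * b ≤ c * d) : a + b ≤ c + d := by
  rcases eq_or_ne c ∞ with rfl | hc
  · simp
  rcases eq_or_ne d ∞ with rfl | hd
  · simp
  lift c to ℝ≥0 using hc
  lift d to ℝ≥0 using hd
  lift a to ℝ≥0 using ne_top_of_le_ne_top ENNReal.coe_ne_top ha
  lift b to ℝ≥0 using ne_top_of_le_ne_top ENNReal.coe_ne_top hb
  norm_cast at *
  rcases eq_or_lt_of_le (zero_le : 0 ≤ c) with rfl | hc
  · simp [nonpos_iff_eq_zero.mp ha, nonpos_iff_eq_zero.mp hb]
  · have ha' : (a : ℝ) ≤ c := ha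
    have hb' : (b : ℝ) ≤ c := hb
    have h' : (a : ℝ) * b ≤ c * d := by exact_mod_cast h
    have hc' : (0 : ℝ) < c := hc
    have : (a : ℝ) + b ≤ c + d := by
      by_contra! hlt
      -- (c - a)(c - b) ≥ 0 gives c(a + b) ≤ c² + ab ≤ c(c + d).
      nlinarith [mul_nonneg (sub_nonneg.mpr ha') (sub_nonneg.mpr hb'),
        _root_.mul_pos hc' (sub_pos.mpr hlt)]
    exact_mod_cast this

/-- The four functions theorem on a linear order. -/
theorem lintegral_mul_lintegral_le_of_linearOrder {R : Type*} [LinearOrder R] [MeasurableSpace R]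
    (σ : Measure R) {α β γ δ : R → ℝ≥0∞} (hα : Measurable α) (hβ : Measurable β)
    (hγ : Measurable γ) (hδ : Measurable δ)
    (h : ∀ x y, α x * β y ≤ γ (x ⊔ y) * δ (x ⊓ y)) :
    (∫⁻ x, α x ∂σ) * ∫⁻ x, β x ∂σ ≤ (∫⁻ x, γ x ∂σ) * ∫⁻ x, δ x ∂σ := by
  -- Symmetrizing the double integral in x and y reduces the claim to a pointwise bound on sums of
  -- two terms.
  have key : ∀ {f g : R → ℝ≥0∞}, Measurable f → Measurable g →
      ∫⁻ x, ∫⁻ y, (f x * g y + f y * g x) ∂σ ∂σ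
        = 2 * ((∫⁻ x, f x ∂σ) * ∫⁻ x, g x ∂σ) := by
    intro f g hf hg
    have inner : ∀ x, ∫⁻ y, (f x * g y + f y * g x) ∂σ
        = f x * ∫⁻ y, g y ∂σ + (∫⁻ y, f y ∂σ) * g x := fun x ↦ by
      rw [lintegral_add_left (hg.const_mul _), lintegral_const_mul _ hg, lintegral_mul_const _ hf]
    simp_rw [inner]
    rw [lintegral_add_left (hf.mul_const _), lintegral_mul_const _ hf, lintegral_const_mul _ hg,
      two_mul]
  have hle : ∫⁻ x, ∫⁻ y, (α x * β y + α y * β x) ∂σ ∂σ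
      ≤ ∫⁻ x, ∫⁻ y, (γ x * δ y + γ y * δ x) ∂σ ∂σ := by
    refine lintegral_mono fun x ↦ lintegral_mono fun y ↦ ?_
    dsimp only
    have diag : ∀ z, α z * β z ≤ γ z * δ z := fun z ↦ by simpa using h z z
    -- The product of the two terms regroups into diagonal values, where the hypothesis has x = y.
    have hprod : (α x * β y) * (α y * β x) ≤ (γ x * δ y) * (γ y * δ x) :=
      calc (α x * β y) * (α y * β x) = (α x * β x) * (α y * β y) := by ring
        _ ≤ (γ x * δ x) * (γ y * δ y) := mul_le_mul' (diag x) (diag y)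
        _ = _ := by ring
    rcases le_total x y with hxy | hxy
    · have h1 := h x y
      have h2 := h y x
      rw [sup_eq_right.mpr hxy, inf_eq_left.mpr hxy] at h1
      rw [sup_eq_left.mpr hxy, inf_eq_right.mpr hxy] at h2
      rw [add_comm (γ x * δ y)]
      exact ENNReal.add_le_add_of_mul_le_mul h1 h2 (by rwa [mul_comm (γ y * δ x)])
    · have h1 := h x y
      have h2 := h y x
      rw [sup_eq_left.mpr hxy, inf_eq_right.mpr hxy] at h1
      rw [sup_eq_right.mpr hxy, inf_eq_left.mpr hxy] at h2
      exact ENNReal.add_le_add_of_mul_le_mul h1 h2 hprod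
  rw [key hα hβ, key hγ hδ] at hle
  exact (ENNReal.mul_le_mul_iff_right two_ne_zero ENNReal.ofNat_ne_top).mp hle

theorem lintegral_pi_succ {R : Type*} [MeasurableSpace R] {n : ℕ} (σ : Fin (n + 1) → Measure R)
    [∀ i, SigmaFinite (σ i)] {f : (Fin (n + 1) → R) → ℝ≥0∞} (hf : Measurable f) :
    ∫⁻ x, f x ∂Measure.pi σ
      = ∫⁻ x, ∫⁻ t, f (Fin.cons t x) ∂σ 0 ∂Measure.pi (fun j : Fin n ↦ σ j.succ) := by
  have hmp := (measurePreserving_piFinSuccAbove σ 0).symm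
  rw [← hmp.lintegral_comp hf, lintegral_prod_symm]
  · simp [MeasurableEquiv.piFinSuccAbove, Fin.insertNthEquiv]
  · exact (hf.comp (MeasurableEquiv.measurable _)).aemeasurable

/-- The four functions theorem for a finite product of `σ`-finite measures on a linear order. -/
theorem lintegral_pi_mul_lintegral_pi_le {R : Type*} [LinearOrder R] [MeasurableSpace R] {n : ℕ}
    (σ : Fin n → Measure R) [∀ i, SigmaFinite (σ i)] {α β γ δ : (Fin n → R) → ℝ≥0∞}
    (hα : Measurable α) (hβ : Measurable β) (hγ : Measurable γ) (hδ : Measurable δ)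
    (h : ∀ x y, α x * β y ≤ γ (x ⊔ y) * δ (x ⊓ y)) :
    (∫⁻ x, α x ∂Measure.pi σ) * ∫⁻ x, β x ∂Measure.pi σ
      ≤ (∫⁻ x, γ x ∂Measure.pi σ) * ∫⁻ x, δ x ∂Measure.pi σ := by
  induction n with
  | zero =>
    rw [Measure.pi_of_empty σ Fin.elim0, lintegral_dirac' _ hα, lintegral_dirac' _ hβ,
      lintegral_dirac' _ hγ, lintegral_dirac' _ hδ]
    simpa [Subsingleton.elim (_ ⊔ _ : Fin 0 → R) Fin.elim0, Subsingleton.elim (_ ⊓ _ : Fin 0 → R) Fin.elim0]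
      using h Fin.elim0 Fin.elim0
  | succ n ih =>
    have hcons : Measurable fun p : (Fin n → R) × R ↦ (Fin.cons p.2 p.1 : Fin (n + 1) → R) := by
      refine measurable_pi_lambda _ fun i ↦ ?_
      refine Fin.cases ?_ (fun j ↦ ?_) i
      · simpa using measurable_snd
      · simpa [Function.comp_def] using (measurable_pi_apply j).comp measurable_fst
    have hmeas : ∀ {f : (Fin (n + 1) → R) → ℝ≥0∞}, Measurable f →
        Measurable fun x : Fin n → R ↦ ∫⁻ t, f (Fin.cons t x) ∂σ 0 :=
      fun hf ↦ (hf.comp hcons).lintegral_prod_right'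
    have hsec : ∀ {f : (Fin (n + 1) → R) → ℝ≥0∞}, Measurable f → ∀ x : Fin n → R,
        Measurable fun t ↦ f (Fin.cons t x) :=
      fun hf x ↦ (hf.comp hcons).comp measurable_prodMk_left
    rw [lintegral_pi_succ σ hα, lintegral_pi_succ σ hβ, lintegral_pi_succ σ hγ,
      lintegral_pi_succ σ hδ]
    -- With coordinate 0 integrated out, the four marginals satisfy the hypothesis again, by the
    -- one-dimensional theorem applied to sections.
    refine ih _ (hmeas hα) (hmeas hβ) (hmeas hγ) (hmeas hδ) fun x y ↦ ?_
    refine lintegral_mul_lintegral_le_of_linearOrder (σ 0) (hsec hα x) (hsec hβ y)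
      (hsec hγ (x ⊔ y)) (hsec hδ (x ⊓ y)) fun s t ↦ ?_
    have hsup : (Fin.cons (s ⊔ t) (x ⊔ y) : Fin (n + 1) → R)
        = Fin.cons s x ⊔ Fin.cons t y := by
      ext i; refine Fin.cases ?_ (fun j ↦ ?_) i <;> simp
    have hinf : (Fin.cons (s ⊓ t) (x ⊓ y) : Fin (n + 1) → R)
        = Fin.cons s x ⊓ Fin.cons t y := by
      ext i; refine Fin.cases ?_ (fun j ↦ ?_) i <;> simp
    rw [hsup, hinf]
    exact h _ _

/-! ### Fixing the maximizing coordinate. -/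

section MaxWeight

variable {n : ℕ}

/-- The share of the coordinate `i` in the maximum of `x` over `S`: the reciprocal of the number of
maximizers if `x i` is the maximum, and `0` otherwise. -/
noncomputable def maxWeight (S : Finset (Fin n)) (i : Fin n) (x : Fin n → ℝ) : ℝ≥0∞ :=
  if ∀ j ∈ S, x j ≤ x i then (∑ j ∈ S, if x j = x i then 1 else 0)⁻¹ else 0

theorem measurable_maxWeight (S : Finset (Fin n)) (i : Fin n) : Measurable (maxWeight S i) := by
  refine Measurable.ite ?_ (Measurable.inv (Finset.measurable_fun_sum _ fun j _ ↦ ?_))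
    measurable_const
  · have : {x : Fin n → ℝ | ∀ j ∈ S, x j ≤ x i} = ⋂ j ∈ S, {x | x j ≤ x i} := by ext; simp
    rw [this]
    exact S.measurableSet_biInter fun j _ ↦
      measurableSet_le (measurable_pi_apply j) (measurable_pi_apply i)
  · exact Measurable.ite (measurableSet_eq_fun (measurable_pi_apply j) (measurable_pi_apply i))
      measurable_const measurable_const

theorem sum_maxWeight {S : Finset (Fin n)} (hS : S.Nonempty) (x : Fin n → ℝ) :
    ∑ i ∈ S, maxWeight S i x = 1 := by
  classical
  set M := S.filter fun i ↦ ∀ j ∈ S, x j ≤ x i with hM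
  have hne : M.Nonempty := by
    obtain ⟨i, hi, hmax⟩ := S.exists_max_image x hS
    exact ⟨i, Finset.mem_filter.mpr ⟨hi, hmax⟩⟩
  have hw : ∀ i ∈ M, (∑ j ∈ S, if x j = x i then (1 : ℝ≥0∞) else 0)⁻¹ = (M.card : ℝ≥0∞)⁻¹ := by
    intro i hi
    rw [hM, Finset.mem_filter] at hi
    rw [Finset.sum_boole]
    congr 3
    ext j
    rw [hM, Finset.mem_filter, Finset.mem_filter]
    refine and_congr_right fun hj ↦ ⟨fun h k hk ↦ h ▸ hi.2 k hk, fun h ↦ ?_⟩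
    exact le_antisymm (hi.2 j hj) (h i hi.1)
  unfold maxWeight
  rw [← Finset.sum_filter, Finset.sum_congr rfl hw, Finset.sum_const, nsmul_eq_mul]
  exact ENNReal.mul_inv_cancel (by simpa using hne.ne_empty) (ENNReal.natCast_ne_top _)

theorem eq_sup'_of_maxWeight_ne_zero {S : Finset (Fin n)} (hS : S.Nonempty) {i : Fin n}
    (hi : i ∈ S) {x : Fin n → ℝ} (h : maxWeight S i x ≠ 0) : S.sup' hS x = x i := by
  have hmax : ∀ j ∈ S, x j ≤ x i := by
    by_contra hcon
    exact h (if_neg hcon)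
  exact le_antisymm (Finset.sup'_le hS x hmax) (Finset.le_sup' x hi)

/-- If x i and y i are maximal over S and x i < y i, then both stay maximal in x ⊓ y and x ⊔ y
respectively. Every maximizer of x ⊔ y is one of y, and every maximizer of x ⊓ y is one of x, so the
tie counts can only drop. -/
theorem maxWeight_mul_le {S : Finset (Fin n)} {i : Fin n} {x y : Fin n → ℝ} (hxy : x i < y i) :
    maxWeight S i x * maxWeight S i y ≤ maxWeight S i (x ⊔ y) * maxWeight S i (x ⊓ y) := by
  by_cases hx : ∀ j ∈ S, x j ≤ x i
  swap
  · rw [maxWeight, if_neg hx, zero_mul]; exact zero_le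
  by_cases hy : ∀ j ∈ S, y j ≤ y i
  swap
  · rw [mul_comm, maxWeight, if_neg hy, zero_mul]; exact zero_le
  have hsup : (x ⊔ y) i = y i := sup_eq_right.mpr hxy.le
  have hinf : (x ⊓ y) i = x i := inf_eq_left.mpr hxy.le
  have hsup' : ∀ j ∈ S, (x ⊔ y) j ≤ (x ⊔ y) i := fun j hj ↦ by
    rw [hsup]; exact sup_le ((hx j hj).trans hxy.le) (hy j hj)
  have hinf' : ∀ j ∈ S, (x ⊓ y) j ≤ (x ⊓ y) i := fun j hj ↦ by
    rw [hinf]; exact inf_le_left.trans (hx j hj)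
  rw [mul_comm]
  unfold maxWeight
  rw [if_pos hx, if_pos hy, if_pos hsup', if_pos hinf', hsup, hinf]
  have hle : ∀ {p q : Prop} [Decidable p] [Decidable q], (p → q) →
      (if p then (1 : ℝ≥0∞) else 0) ≤ if q then 1 else 0 := fun h ↦ by
    split_ifs <;> simp_all
  refine mul_le_mul' (ENNReal.inv_le_inv.mpr (Finset.sum_le_sum fun j hj ↦ hle fun h ↦ ?_))
    (ENNReal.inv_le_inv.mpr (Finset.sum_le_sum fun j hj ↦ hle fun h ↦ ?_))
  · rcases le_total (x j) (y j) with hj' | hj'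
    · rwa [Pi.sup_apply, sup_eq_right.mpr hj'] at h
    · rw [Pi.sup_apply, sup_eq_left.mpr hj'] at h
      exact absurd (h ▸ hx j hj) hxy.not_ge
  · exact le_antisymm (hx j hj) (h ▸ inf_le_left)

theorem maxWeight_comp_perm {S : Finset (Fin n)} {i : Fin n} (π : Equiv.Perm (Fin n))
    (hπ : ∀ j, π j ∈ S ↔ j ∈ S) (x : Fin n → ℝ) :
    maxWeight S i (fun j ↦ x (π j)) = maxWeight S (π i) x := by
  have hsum : (∑ j ∈ S, if x (π j) = x (π i) then (1 : ℝ≥0∞) else 0)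
      = ∑ j ∈ S, if x j = x (π i) then 1 else 0 :=
    Finset.sum_equiv π (fun j ↦ (hπ j).symm) fun _ _ ↦ rfl
  have hall : (∀ j ∈ S, x (π j) ≤ x (π i)) ↔ ∀ j ∈ S, x j ≤ x (π i) :=
    ⟨fun h j hj ↦ by simpa using h (π.symm j) ((hπ _).mp (by simpa using hj)),
      fun h j hj ↦ h _ ((hπ j).mpr hj)⟩
  unfold maxWeight
  simp only [hsum, hall]

/-- For a symmetric law, an integral over the event that the maximum over `S` lies in `C` reduces
to the event that a given coordinate of `S` is the maximizer. -/
theorem IsSymmetricLaw.lintegral_sup' {P : Measure (Fin n → ℝ)} (hP : IsSymmetricLaw P)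
    {S : Finset (Fin n)} (hS : S.Nonempty) {k : Fin n} (hk : k ∈ S)
    {Φ : ({i : Fin n // i ∉ S} → ℝ) → ℝ≥0∞} (hΦ : Measurable Φ) {C : Set ℝ}
    (hC : MeasurableSet C) :
    ∫⁻ x, Φ (fun i ↦ x i) * C.indicator 1 (S.sup' hS x) ∂P
      = S.card * ∫⁻ x, Φ (fun i ↦ x i) * C.indicator 1 (x k) * maxWeight S k x ∂P := by
  have hmeas : ∀ i, Measurable fun x : Fin n → ℝ ↦
      Φ (fun j ↦ x j) * C.indicator 1 (x i) * maxWeight S i x := fun i ↦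
    ((hΦ.comp (measurable_pi_lambda _ fun j ↦ measurable_pi_apply _)).mul
      ((measurable_one.indicator hC).comp (measurable_pi_apply i))).mul (measurable_maxWeight S i)
  have hsplit : ∀ x : Fin n → ℝ, Φ (fun i ↦ x i) * C.indicator 1 (S.sup' hS x)
      = ∑ i ∈ S, Φ (fun j ↦ x j) * C.indicator 1 (x i) * maxWeight S i x := fun x ↦ by
    conv_lhs => rw [← mul_one (Φ _ * _), ← sum_maxWeight hS x, Finset.mul_sum]
    refine Finset.sum_congr rfl fun i hi ↦ ?_
    by_cases h : maxWeight S i x = 0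
    · simp [h]
    · rw [eq_sup'_of_maxWeight_ne_zero hS hi h]
  have hswap : ∀ i ∈ S, ∫⁻ x, Φ (fun j ↦ x j) * C.indicator 1 (x i) * maxWeight S i x ∂P
      = ∫⁻ x, Φ (fun j ↦ x j) * C.indicator 1 (x k) * maxWeight S k x ∂P := by
    intro i hi
    have hmem : ∀ j, Equiv.swap i k j ∈ S ↔ j ∈ S := fun j ↦ by
      rcases eq_or_ne j i with rfl | h1
      · simp [hi, hk]
      rcases eq_or_ne j k with rfl | h2
      · simp [hi, hk]
      rw [Equiv.swap_apply_of_ne_of_ne h1 h2]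
    -- The transposition of i and k preserves S and fixes every coordinate outside S, so Φ is
    -- unaffected.
    conv_lhs => rw [← hP (Equiv.swap i k)]
    rw [lintegral_map (hmeas i) (measurable_pi_lambda _ fun j ↦ measurable_pi_apply _)]
    refine lintegral_congr fun x ↦ ?_
    rw [maxWeight_comp_perm _ hmem, Equiv.swap_apply_left]
    congr 3
    ext j
    rw [Equiv.swap_apply_of_ne_of_ne (ne_of_mem_of_not_mem hi j.2).symm
      (ne_of_mem_of_not_mem hk j.2).symm]
  simp_rw [hsplit]
  rw [lintegral_finsetSum _ fun i _ ↦ hmeas i, Finset.sum_congr rfl hswap, Finset.sum_const,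
    nsmul_eq_mul]

/-- The four functions theorem, one function for each integral, multiplied by the density. The left
side vanishes unless x k ∈ A and y k ∈ B; then x k < y k, so x ⊔ y takes its k-th coordinate from y
and x ⊓ y from x. -/
theorem IsMTP2.lintegral_maxWeight_mul_le {P : Measure (Fin n → ℝ)} (hP : IsMTP2 P)
    (S : Finset (Fin n)) (k : Fin n) {Φ : ({i : Fin n // i ∉ S} → ℝ) → ℝ≥0∞}
    (hΦ : Measurable Φ) (hmono : Monotone Φ) {A B : Set ℝ} (hA : MeasurableSet A)
    (hB : MeasurableSet B) (hAB : ∀ a ∈ A, ∀ b ∈ B, a < b) :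
    (∫⁻ x, Φ (fun i ↦ x i) * A.indicator 1 (x k) * maxWeight S k x ∂P)
        * ∫⁻ x, B.indicator 1 (x k) * maxWeight S k x ∂P
      ≤ (∫⁻ x, Φ (fun i ↦ x i) * B.indicator 1 (x k) * maxWeight S k x ∂P)
        * ∫⁻ x, A.indicator 1 (x k) * maxWeight S k x ∂P := by
  obtain ⟨σ, hσ, f, hf, hfm, rfl⟩ := hP
  have hf' : Measurable fun x ↦ (f x : ℝ≥0∞) := hf.coe_nnreal_ennreal
  have hmeas₁ : ∀ {C : Set ℝ}, MeasurableSet C → Measurable fun x : Fin n → ℝ ↦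
      C.indicator (1 : ℝ → ℝ≥0∞) (x k) * maxWeight S k x := fun hC ↦
    ((measurable_one.indicator hC).comp (measurable_pi_apply k)).mul (measurable_maxWeight S k)
  have hmeas₂ : ∀ {C : Set ℝ}, MeasurableSet C → Measurable fun x : Fin n → ℝ ↦
      Φ (fun j ↦ x j) * C.indicator 1 (x k) * maxWeight S k x := fun hC ↦
    ((hΦ.comp (measurable_pi_lambda _ fun j ↦ measurable_pi_apply _)).mul
      ((measurable_one.indicator hC).comp (measurable_pi_apply k))).mul (measurable_maxWeight S k)
  rw [lintegral_withDensity_eq_lintegral_mul _ hf' (hmeas₂ hA),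
    lintegral_withDensity_eq_lintegral_mul _ hf' (hmeas₁ hB),
    lintegral_withDensity_eq_lintegral_mul _ hf' (hmeas₂ hB),
    lintegral_withDensity_eq_lintegral_mul _ hf' (hmeas₁ hA)]
  refine lintegral_pi_mul_lintegral_pi_le σ (hf'.mul (hmeas₂ hA)) (hf'.mul (hmeas₁ hB))
    (hf'.mul (hmeas₂ hB)) (hf'.mul (hmeas₁ hA)) fun x y ↦ ?_
  simp only [Pi.mul_apply]
  by_cases hx : x k ∈ A
  swap
  · simp [hx]
  by_cases hy : y k ∈ B
  swap
  · simp [hy]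
  have hlt := hAB _ hx _ hy
  have hsup : (x ⊔ y) k = y k := sup_eq_right.mpr hlt.le
  have hinf : (x ⊓ y) k = x k := inf_eq_left.mpr hlt.le
  rw [hsup, hinf, Set.indicator_of_mem hx, Set.indicator_of_mem hy]
  simp only [Pi.one_apply, mul_one, one_mul]
  have hΦle : Φ (fun i ↦ x i) ≤ Φ (fun i ↦ (x ⊔ y) i) := hmono fun i ↦ le_sup_left
  have hfle : (f x : ℝ≥0∞) * f y ≤ f (x ⊔ y) * f (x ⊓ y) := by exact_mod_cast hfm x y
  calc (f x : ℝ≥0∞) * (Φ (fun i ↦ x i) * maxWeight S k x) * (f y * maxWeight S k y)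
      = (f x * f y) * Φ (fun i ↦ x i) * (maxWeight S k x * maxWeight S k y) := by ring
    _ ≤ (f (x ⊔ y) * f (x ⊓ y)) * Φ (fun i ↦ (x ⊔ y) i)
          * (maxWeight S k (x ⊔ y) * maxWeight S k (x ⊓ y)) :=
        mul_le_mul' (mul_le_mul' hfle hΦle) (maxWeight_mul_le hlt)
    _ = _ := by ring

theorem IsMTP2.lintegral_sup'_mul_le {P : Measure (Fin n → ℝ)} (hP : IsMTP2 P)
    (hsymm : IsSymmetricLaw P) {S : Finset (Fin n)} (hS : S.Nonempty)
    {Φ : ({i : Fin n // i ∉ S} → ℝ) → ℝ≥0∞} (hΦ : Measurable Φ) (hmono : Monotone Φ)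
    {A B : Set ℝ} (hA : MeasurableSet A) (hB : MeasurableSet B)
    (hAB : ∀ a ∈ A, ∀ b ∈ B, a < b) :
    (∫⁻ x in S.sup' hS ⁻¹' A, Φ (fun i ↦ x i) ∂P) * P (S.sup' hS ⁻¹' B)
      ≤ (∫⁻ x in S.sup' hS ⁻¹' B, Φ (fun i ↦ x i) ∂P) * P (S.sup' hS ⁻¹' A) := by
  obtain ⟨k, hk⟩ := id hS
  have hsup : Measurable (S.sup' hS : (Fin n → ℝ) → ℝ) := by
    have := S.measurable_sup' hS fun i _ ↦ measurable_pi_apply (X := fun _ : Fin n ↦ ℝ) i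
    convert this using 1
    ext x
    exact (Finset.sup'_apply hS (fun i (x : Fin n → ℝ) ↦ x i) x).symm
  have hset : ∀ {Ψ : ({i : Fin n // i ∉ S} → ℝ) → ℝ≥0∞} {C : Set ℝ}, Measurable Ψ →
      MeasurableSet C → ∫⁻ x in S.sup' hS ⁻¹' C, Ψ (fun i ↦ x i) ∂P
        = S.card * ∫⁻ x, Ψ (fun i ↦ x i) * C.indicator 1 (x k) * maxWeight S k x ∂P := by
    intro Ψ C hΨ hC
    rw [← hsymm.lintegral_sup' hS hk hΨ hC, ← lintegral_indicator (hsup hC)]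
    refine lintegral_congr fun x ↦ ?_
    by_cases hx : S.sup' hS x ∈ C <;> simp [Set.indicator, hx]
  have hone : ∀ {C : Set ℝ}, MeasurableSet C → P (S.sup' hS ⁻¹' C)
      = S.card * ∫⁻ x, C.indicator 1 (x k) * maxWeight S k x ∂P := by
    intro C hC
    simpa using hset (Ψ := fun _ ↦ 1) measurable_const hC
  have hcomm : ∀ s a b : ℝ≥0∞, s * a * (s * b) = s * s * (a * b) := fun s a b ↦ by ring
  rw [hset hΦ hA, hset hΦ hB, hone hA, hone hB, hcomm, hcomm]
  exact mul_le_mul_right (hP.lintegral_maxWeight_mul_le S k hΦ hmono hA hB hAB) _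

end MaxWeight

/-! ### From ordered averages to monotonicity almost everywhere. -/

/-- A function whose averages over sets lying to the left of each other are ordered is monotone on
a set of full measure. -/
theorem aeMonotone_of_setIntegral_mul_le {ν : Measure ℝ} [IsFiniteMeasure ν] {h : ℝ → ℝ}
    (hm : Measurable h) (hi : Integrable h ν)
    (H : ∀ A B : Set ℝ, MeasurableSet A → MeasurableSet B → (∀ a ∈ A, ∀ b ∈ B, a < b) →
      (∫ z in A, h z ∂ν) * ν.real B ≤ (∫ z in B, h z ∂ν) * ν.real A) :
    AEMonotone ν h := by
  -- Rational cut p.1 and level p.2: left of the cut and above the level, against right of the cut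
  -- and at most the level. If both sets had positive measure, their averages would be in the wrong
  -- order.
  let A : ℚ × ℚ → Set ℝ := fun p ↦ {z | z ≤ p.1 ∧ (p.2 : ℝ) < h z}
  let B : ℚ × ℚ → Set ℝ := fun p ↦ {z | (p.1 : ℝ) < z ∧ h z ≤ p.2}
  have hA : ∀ p, MeasurableSet (A p) := fun p ↦
    measurableSet_Iic.inter (measurableSet_lt measurable_const hm)
  have hB : ∀ p, MeasurableSet (B p) := fun p ↦
    measurableSet_Ioi.inter (measurableSet_le hm measurable_const)
  have hnull : ∀ p, ν (A p) = 0 ∨ ν (B p) = 0 := by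
    intro p
    by_contra! hne
    have hApos : 0 < ν.real (A p) := by
      rw [measureReal_def]; exact ENNReal.toReal_pos hne.1 (measure_ne_top _ _)
    have hBpos : 0 < ν.real (B p) := by
      rw [measureReal_def]; exact ENNReal.toReal_pos hne.2 (measure_ne_top _ _)
    have hle := H (A p) (B p) (hA p) (hB p) fun a ha b hb ↦ ha.1.trans_lt hb.1
    have hAint : (p.2 : ℝ) * ν.real (A p) < ∫ z in A p, h z ∂ν := by
      have hpos : 0 < ∫ z in A p, (h z - p.2) ∂ν := by
        rw [setIntegral_pos_iff_support_of_nonneg_ae]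
        · refine lt_of_lt_of_le (pos_iff_ne_zero.mpr hne.1) (measure_mono fun z hz ↦ ⟨?_, hz⟩)
          exact (sub_pos.mpr hz.2).ne'
        · filter_upwards [ae_restrict_mem (hA p)] with z hz using (sub_pos.mpr hz.2).le
        · exact (hi.sub (integrable_const _)).integrableOn
      rw [integral_sub hi.integrableOn (integrable_const _)] at hpos
      simp only [integral_const, smul_eq_mul, measureReal_restrict_apply_univ] at hpos
      linarith
    have hBint : ∫ z in B p, h z ∂ν ≤ p.2 * ν.real (B p) := by
      have := setIntegral_mono_on (μ := ν) hi.integrableOn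
        (integrable_const (p.2 : ℝ)).integrableOn (hB p) fun z hz ↦ hz.2
      simpa [mul_comm] using this
    nlinarith [mul_lt_mul_of_pos_right hAint hBpos, mul_le_mul_of_nonneg_right hBint hApos.le]
  -- Only countably many null sets are discarded; any descent of `h` would place its two points in
  -- some `A p` and `B p`, one of which has been removed.
  refine ⟨{z | ∀ p, (ν (A p) = 0 → z ∉ A p) ∧ (ν (B p) = 0 → z ∉ B p)}, ?_, ?_⟩
  · refine ae_all_iff.mpr fun p ↦ Filter.Eventually.and ?_ ?_
    · by_cases h0 : ν (A p) = 0
      · filter_upwards [measure_eq_zero_iff_ae_notMem.mp h0] with z hz _ using hz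
      · exact .of_forall fun z hz ↦ absurd hz h0
    · by_cases h0 : ν (B p) = 0
      · filter_upwards [measure_eq_zero_iff_ae_notMem.mp h0] with z hz _ using hz
      · exact .of_forall fun z hz ↦ absurd hz h0
  · intro z hz w hw hzw
    by_contra! hlt
    have hne : z < w := lt_of_le_of_ne hzw fun he ↦ by simp [he] at hlt
    obtain ⟨q, hq1, hq2⟩ := exists_rat_btwn hne
    obtain ⟨c, hc1, hc2⟩ := exists_rat_btwn hlt
    rcases hnull (q, c) with h0 | h0
    · exact (hz (q, c)).1 h0 ⟨hq1.le, hc2⟩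
    · exact (hw (q, c)).2 h0 ⟨hq2, hc1.le⟩

theorem AEMonotone.aeAntitone_neg {ν : Measure ℝ} {h : ℝ → ℝ} (hh : AEMonotone ν h) :
    AEAntitone ν (fun z ↦ -h z) := by
  obtain ⟨A, hA, hm⟩ := hh
  exact ⟨A, hA, hm.neg⟩

/-! ### Conditional means and their integrals over events. -/

section CondMean

variable {Ω : Type*} [MeasurableSpace Ω] {n : ℕ}

theorem measurable_restOf {X : Fin n → Ω → ℝ} (hX : ∀ i, Measurable (X i)) (S : Finset (Fin n)) :
    Measurable (restOf X S) :=
  measurable_pi_lambda _ fun i ↦ hX i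

theorem measurable_condMean (μ : Measure Ω) [IsFiniteMeasure μ] (X : Fin n → Ω → ℝ)
    (S : Finset (Fin n)) (Y : Ω → ℝ) {φ : ({i : Fin n // i ∉ S} → ℝ) → ℝ} (hφ : Measurable φ) :
    Measurable (condMean μ X S Y φ) :=
  (hφ.comp measurable_snd).stronglyMeasurable.integral_condDistrib.measurable

theorem integrable_condMean {μ : Measure Ω} [IsFiniteMeasure μ] {X : Fin n → Ω → ℝ}
    (hX : ∀ i, Measurable (X i)) (S : Finset (Fin n)) {Y : Ω → ℝ} (hY : Measurable Y)
    {φ : ({i : Fin n // i ∉ S} → ℝ) → ℝ} (hφ : Measurable φ)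
    (hint : Integrable (fun ω ↦ φ (restOf X S ω)) μ) :
    Integrable (condMean μ X S Y φ) (μ.map Y) := by
  have hR := measurable_restOf hX S
  rw [integrable_map_measure (measurable_condMean μ X S Y hφ).aestronglyMeasurable hY.aemeasurable]
  exact integrable_condExp.congr
    (condExp_ae_eq_integral_condDistrib hY hR.aemeasurable hφ.stronglyMeasurable hint)

theorem setIntegral_condMean {μ : Measure Ω} [IsFiniteMeasure μ] {X : Fin n → Ω → ℝ}
    (hX : ∀ i, Measurable (X i)) (S : Finset (Fin n)) {Y : Ω → ℝ} (hY : Measurable Y)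
    {φ : ({i : Fin n // i ∉ S} → ℝ) → ℝ} (hφ : Measurable φ)
    (hint : Integrable (fun ω ↦ φ (restOf X S ω)) μ) {A : Set ℝ} (hA : MeasurableSet A) :
    ∫ z in A, condMean μ X S Y φ z ∂(μ.map Y) = ∫ ω in Y ⁻¹' A, φ (restOf X S ω) ∂μ := by
  have hR := measurable_restOf hX S
  rw [setIntegral_map hA (measurable_condMean μ X S Y hφ).aestronglyMeasurable hY.aemeasurable,
    ← setIntegral_condExp hY.comap_le hint ⟨A, hA, rfl⟩]
  exact (integral_congr_ae (ae_restrict_of_ae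
    (condExp_ae_eq_integral_condDistrib hY hR.aemeasurable hφ.stronglyMeasurable hint))).symm

/-- Monotone regression follows from the ordering of the averages of `φ` over the events
`Y ∈ A` and `Y ∈ B` with `A` to the left of `B`. -/
theorem regressionMonotone_of_setIntegral_mul_le {μ : Measure Ω} [IsFiniteMeasure μ]
    {X : Fin n → Ω → ℝ} (hX : ∀ i, Measurable (X i)) (S : Finset (Fin n)) {Y : Ω → ℝ}
    (hY : Measurable Y)
    (H : ∀ φ : ({i : Fin n // i ∉ S} → ℝ) → ℝ, Measurable φ → Monotone φ →
      Integrable (fun ω ↦ φ (restOf X S ω)) μ →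
      ∀ A B : Set ℝ, MeasurableSet A → MeasurableSet B → (∀ a ∈ A, ∀ b ∈ B, a < b) →
      (∫ ω in Y ⁻¹' A, φ (restOf X S ω) ∂μ) * μ.real (Y ⁻¹' B)
        ≤ (∫ ω in Y ⁻¹' B, φ (restOf X S ω) ∂μ) * μ.real (Y ⁻¹' A)) :
    RegressionMonotone μ X S Y := by
  have mono : ∀ φ : ({i : Fin n // i ∉ S} → ℝ) → ℝ, Measurable φ → Monotone φ →
      Integrable (fun ω ↦ φ (restOf X S ω)) μ → AEMonotone (μ.map Y) (condMean μ X S Y φ) := by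
    intro φ hφ hmono hint
    refine aeMonotone_of_setIntegral_mul_le (measurable_condMean μ X S Y hφ)
      (integrable_condMean hX S hY hφ hint) fun A B hA hB hAB ↦ ?_
    rw [setIntegral_condMean hX S hY hφ hint hA, setIntegral_condMean hX S hY hφ hint hB,
      map_measureReal_apply hY hA, map_measureReal_apply hY hB]
    exact H φ hφ hmono hint A B hA hB hAB
  intro φ hφ hint
  refine ⟨fun hmono ↦ mono φ hφ hmono hint, fun hanti ↦ ?_⟩
  have := (mono (fun r ↦ -φ r) hφ.neg hanti.neg hint.neg).aeAntitone_neg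
  convert this using 2 with z
  simp [condMean, integral_neg]

end CondMean

/-! ### The inequality for maxima, and for minima by reflection. -/

theorem maxOver_neg {Ω : Type*} {n : ℕ} (X : Fin n → Ω → ℝ) {S : Finset (Fin n)} (hS : S.Nonempty) (ω : Ω) :
    maxOver (fun i ω ↦ -X i ω) S hS ω = -minOver X S hS ω := by
  refine le_antisymm (Finset.sup'_le _ _ fun i hi ↦ neg_le_neg (Finset.inf'_le _ hi)) ?_
  obtain ⟨i, hi, h⟩ := S.exists_mem_eq_inf' hS fun i ↦ X i ω
  rw [minOver, h]
  exact Finset.le_sup' (fun i ↦ -X i ω) hi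

section Regression

variable {Ω : Type*} [MeasurableSpace Ω] {n : ℕ}

theorem measurable_maxOver {X : Fin n → Ω → ℝ} (hX : ∀ i, Measurable (X i)) {S : Finset (Fin n)}
    (hS : S.Nonempty) : Measurable (maxOver X S hS) := by
  have := S.measurable_sup' hS fun i _ ↦ hX i
  convert this using 1
  ext ω
  exact (Finset.sup'_apply hS X ω).symm

theorem setIntegral_maxOver_mul_le_of_nonneg {μ : Measure Ω} [IsFiniteMeasure μ]
    {X : Fin n → Ω → ℝ} (hX : ∀ i, Measurable (X i))
    (hsymm : IsSymmetricLaw (μ.map (fun ω i ↦ X i ω))) (hmtp : IsMTP2 (μ.map (fun ω i ↦ X i ω)))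
    {S : Finset (Fin n)} (hS : S.Nonempty) {φ : ({i : Fin n // i ∉ S} → ℝ) → ℝ}
    (hφ : Measurable φ) (hmono : Monotone φ) (h0 : ∀ r, 0 ≤ φ r)
    (hint : Integrable (fun ω ↦ φ (restOf X S ω)) μ) {A B : Set ℝ} (hA : MeasurableSet A)
    (hB : MeasurableSet B) (hAB : ∀ a ∈ A, ∀ b ∈ B, a < b) :
    (∫ ω in maxOver X S hS ⁻¹' A, φ (restOf X S ω) ∂μ) * μ.real (maxOver X S hS ⁻¹' B)
      ≤ (∫ ω in maxOver X S hS ⁻¹' B, φ (restOf X S ω) ∂μ) * μ.real (maxOver X S hS ⁻¹' A) := by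
  have hXm : Measurable fun ω i ↦ X i ω := measurable_pi_lambda _ hX
  have hΦ : Measurable fun r ↦ ENNReal.ofReal (φ r) := hφ.ennreal_ofReal
  have hsup : Measurable (S.sup' hS : (Fin n → ℝ) → ℝ) :=
    measurable_maxOver (X := fun i (x : Fin n → ℝ) ↦ x i) measurable_pi_apply hS
  have hrest : Measurable fun (x : Fin n → ℝ) (i : {i // i ∉ S}) ↦ x i :=
    measurable_pi_lambda _ fun i ↦ measurable_pi_apply _
  have hcomp : Measurable fun x : Fin n → ℝ ↦ ENNReal.ofReal (φ fun i ↦ x i) := hΦ.comp hrest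
  have hle := hmtp.lintegral_sup'_mul_le hsymm hS hΦ
    (fun r s hrs ↦ ENNReal.ofReal_le_ofReal (hmono hrs)) hA hB hAB
  rw [setLIntegral_map (hsup hA) hcomp hXm,
    setLIntegral_map (hsup hB) hcomp hXm,
    Measure.map_apply hXm (hsup hA), Measure.map_apply hXm (hsup hB)] at hle
  have heq : ∀ C : Set ℝ, ∫ ω in maxOver X S hS ⁻¹' C, φ (restOf X S ω) ∂μ
      = (∫⁻ ω in maxOver X S hS ⁻¹' C, ENNReal.ofReal (φ (restOf X S ω)) ∂μ).toReal := fun C ↦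
    integral_eq_lintegral_of_nonneg_ae (.of_forall fun ω ↦ h0 _)
      hint.aestronglyMeasurable.restrict
  rw [heq, heq, measureReal_def, measureReal_def, ← ENNReal.toReal_mul, ← ENNReal.toReal_mul]
  refine ENNReal.toReal_mono (ENNReal.mul_ne_top ?_ (measure_ne_top _ _)) hle
  exact hint.restrict.lintegral_lt_top.ne

theorem setIntegral_maxOver_mul_le {μ : Measure Ω} [IsFiniteMeasure μ]
    {X : Fin n → Ω → ℝ} (hX : ∀ i, Measurable (X i))
    (hsymm : IsSymmetricLaw (μ.map (fun ω i ↦ X i ω))) (hmtp : IsMTP2 (μ.map (fun ω i ↦ X i ω)))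
    {S : Finset (Fin n)} (hS : S.Nonempty) {φ : ({i : Fin n // i ∉ S} → ℝ) → ℝ}
    (hφ : Measurable φ) (hmono : Monotone φ)
    (hint : Integrable (fun ω ↦ φ (restOf X S ω)) μ) {A B : Set ℝ} (hA : MeasurableSet A)
    (hB : MeasurableSet B) (hAB : ∀ a ∈ A, ∀ b ∈ B, a < b) :
    (∫ ω in maxOver X S hS ⁻¹' A, φ (restOf X S ω) ∂μ) * μ.real (maxOver X S hS ⁻¹' B)
      ≤ (∫ ω in maxOver X S hS ⁻¹' B, φ (restOf X S ω) ∂μ) * μ.real (maxOver X S hS ⁻¹' A) := by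
  have hint' : ∀ N : ℕ, Integrable (fun ω ↦ max (φ (restOf X S ω)) (-N)) μ := fun N ↦
    hint.sup (integrable_const _)
  have htrunc : ∀ N : ℕ,
      (∫ ω in maxOver X S hS ⁻¹' A, max (φ (restOf X S ω)) (-N) ∂μ) * μ.real (maxOver X S hS ⁻¹' B)
        ≤ (∫ ω in maxOver X S hS ⁻¹' B, max (φ (restOf X S ω)) (-N) ∂μ)
          * μ.real (maxOver X S hS ⁻¹' A) := fun N ↦ by
    -- Adding N makes the truncation nonnegative and adds the same amount, N μ(Y ∈ A) μ(Y ∈ B), to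
    -- both sides.
    have hle := setIntegral_maxOver_mul_le_of_nonneg hX hsymm hmtp hS
      (φ := fun r ↦ max (φ r) (-N) + N) ((hφ.max measurable_const).add_const _)
      ((hmono.max monotone_const).add_const _)
      (fun r ↦ by linarith [le_max_right (φ r) (-(N : ℝ))])
      ((hint' N).add (integrable_const _)) hA hB hAB
    have hadd : ∀ C : Set ℝ,
        ∫ ω in maxOver X S hS ⁻¹' C, (max (φ (restOf X S ω)) (-N) + N) ∂μ
          = (∫ ω in maxOver X S hS ⁻¹' C, max (φ (restOf X S ω)) (-N) ∂μ)
            + μ.real (maxOver X S hS ⁻¹' C) * N := fun C ↦ by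
      rw [integral_add (hint' N).restrict (integrable_const _)]
      simp
    rw [hadd, hadd] at hle
    linarith
  have hlim : ∀ C : Set ℝ, Filter.Tendsto
      (fun N : ℕ ↦ ∫ ω in maxOver X S hS ⁻¹' C, max (φ (restOf X S ω)) (-N) ∂μ) Filter.atTop
      (nhds (∫ ω in maxOver X S hS ⁻¹' C, φ (restOf X S ω) ∂μ)) := fun C ↦ by
    refine tendsto_integral_of_dominated_convergence (fun ω ↦ |φ (restOf X S ω)|)
      (fun N ↦ (hint' N).aestronglyMeasurable.restrict) hint.abs.restrict
      (fun N ↦ .of_forall fun ω ↦ ?_) (.of_forall fun ω ↦ ?_)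
    · rw [Real.norm_eq_abs]
      refine abs_le.mpr ⟨(neg_abs_le _).trans (le_max_left _ _), max_le (le_abs_self _) ?_⟩
      exact (neg_nonpos.mpr N.cast_nonneg).trans (abs_nonneg _)
    · obtain ⟨M, hM⟩ := exists_nat_ge (-φ (restOf X S ω))
      refine tendsto_const_nhds.congr' ?_
      filter_upwards [Filter.eventually_ge_atTop M] with N hN
      refine (max_eq_left ?_).symm
      have : (M : ℝ) ≤ N := by exact_mod_cast hN
      linarith
  exact le_of_tendsto_of_tendsto' ((hlim A).mul_const _) ((hlim B).mul_const _) htrunc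

theorem IsSymmetricLaw.neg {P : Measure (Fin n → ℝ)} (hP : IsSymmetricLaw P) :
    IsSymmetricLaw (P.map fun x ↦ -x) := by
  intro π
  have hπ : Measurable fun (x : Fin n → ℝ) i ↦ x (π i) :=
    measurable_pi_lambda _ fun i ↦ measurable_pi_apply _
  rw [Measure.map_map hπ measurable_neg]
  conv_rhs => rw [← hP π, Measure.map_map measurable_neg hπ]
  rfl

/-- Negation exchanges ⊔ and ⊓, which leaves the inequality for the density unchanged; the reference
measures are reflected too. -/
theorem IsMTP2.neg {P : Measure (Fin n → ℝ)} (hP : IsMTP2 P) : IsMTP2 (P.map fun x ↦ -x) := by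
  obtain ⟨σ, hσ, f, hf, hfm, rfl⟩ := hP
  have hσ' : ∀ i, SigmaFinite ((σ i).map fun t ↦ -t) := fun i ↦
    (MeasurableEquiv.neg ℝ).sigmaFinite_map
  have hpi : (Measure.pi σ).map (fun x ↦ -x) = Measure.pi fun i ↦ (σ i).map fun t ↦ -t :=
    (measurePreserving_pi σ _ fun i ↦ measurable_neg.measurePreserving (σ i)).map_eq
  refine ⟨fun i ↦ (σ i).map fun t ↦ -t, hσ', fun x ↦ f (-x), hf.comp measurable_neg, ?_, ?_⟩
  · intro x y
    dsimp only
    rw [neg_sup, neg_inf, mul_comm (f (-x ⊓ -y))]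
    exact hfm _ _
  · have hf' : Measurable fun x ↦ (f (-x) : ℝ≥0∞) :=
      (hf.comp measurable_neg).coe_nnreal_ennreal
    have hneg : Measurable fun x : Fin n → ℝ ↦ -x := measurable_neg
    ext s hs
    rw [Measure.map_apply hneg hs, withDensity_apply _ (hneg hs),
      withDensity_apply _ hs, ← hpi,
      setLIntegral_map hs hf' hneg]
    simp

theorem setIntegral_minOver_mul_le {μ : Measure Ω} [IsFiniteMeasure μ]
    {X : Fin n → Ω → ℝ} (hX : ∀ i, Measurable (X i))
    (hsymm : IsSymmetricLaw (μ.map (fun ω i ↦ X i ω))) (hmtp : IsMTP2 (μ.map (fun ω i ↦ X i ω)))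
    {S : Finset (Fin n)} (hS : S.Nonempty) {φ : ({i : Fin n // i ∉ S} → ℝ) → ℝ}
    (hφ : Measurable φ) (hmono : Monotone φ)
    (hint : Integrable (fun ω ↦ φ (restOf X S ω)) μ) {A B : Set ℝ} (hA : MeasurableSet A)
    (hB : MeasurableSet B) (hAB : ∀ a ∈ A, ∀ b ∈ B, a < b) :
    (∫ ω in minOver X S hS ⁻¹' A, φ (restOf X S ω) ∂μ) * μ.real (minOver X S hS ⁻¹' B)
      ≤ (∫ ω in minOver X S hS ⁻¹' B, φ (restOf X S ω) ∂μ) * μ.real (minOver X S hS ⁻¹' A) := by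
  have hXm : Measurable fun ω i ↦ X i ω := measurable_pi_lambda _ hX
  have hlaw : μ.map (fun ω i ↦ -X i ω) = (μ.map fun ω i ↦ X i ω).map fun x ↦ -x := by
    rw [Measure.map_map measurable_neg hXm]; rfl
  have hset : ∀ C : Set ℝ, maxOver (fun i ω ↦ -X i ω) S hS ⁻¹' ((fun t ↦ -t) ⁻¹' C)
      = minOver X S hS ⁻¹' C := fun C ↦ by
    ext ω; simp [maxOver_neg]
  have hφneg : ∀ ω, -φ (-restOf (fun i ω ↦ -X i ω) S ω) = -φ (restOf X S ω) := fun ω ↦ by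
    congr 2; ext i; simp [restOf]
  -- r ↦ -φ(-r) is again nondecreasing. Reflection puts -B to the left of -A, so A and B trade
  -- roles, and the outer minus sign turns the inequality back.
  have hle := setIntegral_maxOver_mul_le (X := fun i ω ↦ -X i ω) (fun i ↦ (hX i).neg)
    (hlaw ▸ hsymm.neg) (hlaw ▸ hmtp.neg) hS (φ := fun r ↦ -φ (-r)) (hφ.comp measurable_neg).neg
    (fun r s hrs ↦ neg_le_neg (hmono (neg_le_neg hrs)))
    (by simp only [hφneg]; exact hint.neg)
    (measurable_neg hB) (measurable_neg hA) fun b hb a ha ↦ neg_lt_neg_iff.mp (hAB _ ha _ hb)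
  simp only [hset, hφneg, integral_neg] at hle
  linarith

theorem measurable_minOver {X : Fin n → Ω → ℝ} (hX : ∀ i, Measurable (X i)) {S : Finset (Fin n)}
    (hS : S.Nonempty) : Measurable (minOver X S hS) := by
  have := (measurable_maxOver (fun i ↦ (hX i).neg) hS).neg
  convert this using 1
  ext ω
  exact (neg_eq_iff_eq_neg.mpr (maxOver_neg X hS ω)).symm

end Regression

theorem lemma2p2 {Ω : Type*} [MeasurableSpace Ω] (μ : Measure Ω) [IsProbabilityMeasure μ]
    {n : ℕ} (X : Fin n → Ω → ℝ) (hX : ∀ i, Measurable (X i))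
    (hsymm : IsSymmetricLaw (μ.map (fun ω i => X i ω)))
    (hmtp : IsMTP2 (μ.map (fun ω i => X i ω))) :
    MaxCondition μ X ∧ MinCondition μ X :=
  ⟨fun S hS ↦ regressionMonotone_of_setIntegral_mul_le hX S (measurable_maxOver hX hS)
    fun _ hφ hmono hint _ _ hA hB hAB ↦
      setIntegral_maxOver_mul_le hX hsymm hmtp hS hφ hmono hint hA hB hAB,
   fun S hS ↦ regressionMonotone_of_setIntegral_mul_le hX S (measurable_minOver hX hS)
    fun _ hφ hmono hint _ _ hA hB hAB ↦
      setIntegral_minOver_mul_le hX hsymm hmtp hS hφ hmono hint hA hB hAB⟩
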